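/- For an isometric action of a group $\Gamma$ on a (possibly asymmetric) metric space $(X,d)$, let $\ell_X[g]=\lim_{k\to\infty} d(x,g^kx)/k$ denote the stable translation length of $g\in\Gamma$ (which depends neither on $x\in X$ nor on the choice of $g$ in its conjugacy class). For two isometric actions of $\Gamma$ on $X_*$ and $X$, let $$\mathrm{Dil}(X_*,X)=\inf\{\eta>0 : \ell_{X_*}[g]\le \eta\,\ell_X[g]\ \text{for all } g\in\Gamma\}\in[0,\infty],$$ with $\inf\emptyset=\infty$. A metric space $X_*$ is $\delta$-hyperbolic ($\delta\ge 0$) if $(x|y)_z\ge\min\{(x|w)_z,(y|w)_z\}-\delta$ for all $x,y,z,w\in X_*$, where $(x|y)_z=\frac12(d(x,z)+d(z,y)-d(x,y))$. An isometric action on a hyperbolic space is non-elementary if $\Gamma$ contains two elements of positive stable translation length having no common fixed point in the Gromov boundary. A set $S\subset\Gamma$ is bounded for the action on $X_*$ if $\sup_{s\in S}d(x,sx)<\infty$ for some (equivalently, every) $x\in X_*$. If $S$ generates $\Gamma$ as a semigroup, $|g|_S$ is the least number of factors in an expression of $g$ as a product of elements of $S$ (with $|1|_S=0$), $d_S(g,h)=|g^{-1}h|_S$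 is the distance of the Cayley graph $\mathrm{Cay}(\Gamma,S)$, and $\ell_S$ is the stable translation length for $d_S$. **Theorem.** There exists an absolute constant $K>0$ such that the following holds. Let $\Gamma$ be a group with a non-elementary action by isometries on a $\delta$-hyperbolic metric space $X_*$, and let $S\subset\Gamma$ be a set that generates $\Gamma$ as a semigroup and is bounded for the action on $X_*$ ($S$ need be neither finite nor symmetric). Then for every integer $L\ge 1$, $$\mathrm{Dil}(X_*,\mathrm{Cay}(\Gamma,S))\le \frac{K\delta}{L}+\sup_{0<\ell_S[g]\le 2L}\frac{\ell_{X_*}[g]}{\ell_S[g]},$$ where the supremum is taken in $[0,\infty]$ (so that it is $0$ over the empty set). -/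

import Mathlib

open Filter Topology
open scoped ENNReal Pointwise

noncomputable section

namespace LengthSpectrum

variable {Γ X Y : Type*} [Group Γ]

/-- `d` is a possibly asymmetric pseudo metric on `X` for which the action of `Γ` is isometric. -/
structure IsInvariantDist (Γ : Type*) {X : Type*} [Group Γ] [MulAction Γ X]
    (d : X → X → ℝ) : Prop where
  self : ∀ x, d x x = 0
  nonneg : ∀ x y, 0 ≤ d x y
  triangle : ∀ x y z, d x z ≤ d x y + d y z
  smul : ∀ (g : Γ) x y, d (g • x) (g • y) = d x y

/-- The stable translation length `ℓ_X[g] = lim_k d(x, g^k x) / k` of `g` acting on `(X, d)`.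
By `tendsto_stableLength` the limit exists and does not depend on the base point `x`. -/
def stableLength [MulAction Γ X] [Nonempty X] (d : X → X → ℝ) (g : Γ) : ℝ :=
  limUnder atTop (fun k : ℕ => d (Classical.arbitrary X) (g ^ k • Classical.arbitrary X) / k)

theorem tendsto_stableLength [MulAction Γ X] [Nonempty X] {d : X → X → ℝ}
    (hd : IsInvariantDist Γ d) (g : Γ) (x : X) :
    Tendsto (fun k : ℕ => d x (g ^ k • x) / k) atTop (𝓝 (stableLength d g)) := by
  have key : ∀ y : X, ∃ l, Tendsto (fun k : ℕ => d y (g ^ k • y) / k) atTop (𝓝 l) := by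
    intro y
    have hs : Subadditive (fun k : ℕ => d y (g ^ k • y)) := by
      intro m n
      have h1 := hd.triangle y (g ^ m • y) (g ^ (m + n) • y)
      rw [pow_add, mul_smul, hd.smul] at h1
      simpa [pow_add, mul_smul] using h1
    refine ⟨hs.lim, hs.tendsto_lim ⟨0, ?_⟩⟩
    rintro _ ⟨k, rfl⟩
    exact div_nonneg (hd.nonneg _ _) (Nat.cast_nonneg k)
  set y : X := Classical.arbitrary X with hy
  have h0 : Tendsto (fun k : ℕ => d y (g ^ k • y) / k) atTop (𝓝 (stableLength d g)) :=
    tendsto_nhds_limUnder (key y)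
  have hc : Tendsto (fun k : ℕ => (d x y + d y x) / (k : ℝ)) atTop (𝓝 0) :=
    tendsto_const_div_atTop_nhds_zero_nat _
  have hlow := h0.sub hc
  have hupp := h0.add hc
  rw [sub_zero] at hlow
  rw [add_zero] at hupp
  refine tendsto_of_tendsto_of_tendsto_of_le_of_le hlow hupp ?_ ?_
  · intro k
    have h1 := hd.triangle y x (g ^ k • y)
    have h2 := hd.triangle x (g ^ k • x) (g ^ k • y)
    rw [hd.smul] at h2
    change d y (g ^ k • y) / k - (d x y + d y x) / k ≤ d x (g ^ k • x) / k
    rw [← sub_div]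
    exact div_le_div_of_nonneg_right (by linarith) (Nat.cast_nonneg k)
  · intro k
    have h1 := hd.triangle x y (g ^ k • x)
    have h2 := hd.triangle y (g ^ k • y) (g ^ k • x)
    rw [hd.smul] at h2
    change d x (g ^ k • x) / k ≤ d y (g ^ k • y) / k + (d x y + d y x) / k
    rw [← add_div]
    exact div_le_div_of_nonneg_right (by linarith) (Nat.cast_nonneg k)

/-- The dilation `Dil((Y, e), (X, d)) ∈ [0, ∞]` of two isometric actions of `Γ`:
the infimum of all `η > 0` with `ℓ_Y[g] ≤ η ℓ_X[g]` for all `g`, and `∞` if there is none. -/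
def dilation (Γ : Type*) [Group Γ] [MulAction Γ X] [MulAction Γ Y] [Nonempty X] [Nonempty Y]
    (e : Y → Y → ℝ) (d : X → X → ℝ) : ℝ≥0∞ :=
  sInf {t | ∃ η : ℝ, 0 < η ∧ (∀ g : Γ, stableLength e g ≤ η * stableLength d g) ∧
    t = ENNReal.ofReal η}

/-- The length of `g` with respect to `S`: the least `n` such that `g` is a product of `n`
elements of `S` (here `S ^ n` is the set of products of `n` elements, and `S ^ 0 = {1}`). -/
def wordLength (S : Set Γ) (g : Γ) : ℕ := sInf {n : ℕ | g ∈ S ^ n}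

/-- The path distance `d_S(g, h) = |g⁻¹ h|_S` between vertices of the (directed) Cayley graph
of `Γ` with respect to `S`, on which `Γ` acts by left multiplication. -/
def cayDist (S : Set Γ) (g h : Γ) : ℝ := wordLength S (g⁻¹ * h)

/-- The Gromov product `(x | y)_z`. -/
def gromovProduct [PseudoMetricSpace X] (x y z : X) : ℝ :=
  (dist x z + dist z y - dist x y) / 2

/-- The four-point condition defining `δ`-hyperbolic spaces. -/
def IsHyperbolic (X : Type*) [PseudoMetricSpace X] (δ : ℝ) : Prop :=
  0 ≤ δ ∧ ∀ x y z w : X,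
    min (gromovProduct x w z) (gromovProduct y w z) - δ ≤ gromovProduct x y z

/-- The sequences `a^n x` and `b^n x` are equivalent, i.e. represent the same point of the
Gromov boundary: `(a^m x | b^n x)_x → ∞` as `m, n → ∞`. -/
def SameEndpoint [PseudoMetricSpace X] [MulAction Γ X] (a b : Γ) : Prop :=
  ∀ x : X, Tendsto (fun p : ℕ × ℕ => gromovProduct (a ^ p.1 • x) (b ^ p.2 • x) x) atTop atTop

/-- The action of `Γ` on the hyperbolic space `X` is non-elementary: there are two loxodromic
elements `g`, `h` (i.e. elements of positive stable translation length) that are independent,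
i.e. such that no endpoint `g^{±∞}` in the Gromov boundary equals an endpoint `h^{±∞}`. -/
def IsNonelementary (Γ X : Type*) [Group Γ] [PseudoMetricSpace X] [MulAction Γ X]
    [Nonempty X] : Prop :=
  ∃ g h : Γ, 0 < stableLength (dist : X → X → ℝ) g ∧ 0 < stableLength (dist : X → X → ℝ) h ∧
    ∀ a ∈ ({g, g⁻¹} : Set Γ), ∀ b ∈ ({h, h⁻¹} : Set Γ), ¬ SameEndpoint (X := X) a b

/-- `S` is bounded for the action on `X`: the displacements `d(x, s x)`, `s ∈ S`, are bounded
for some (equivalently, every) `x`. -/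
def IsBoundedFor (X : Type*) [PseudoMetricSpace X] [MulAction Γ X] (S : Set Γ) : Prop :=
  ∃ x : X, ∃ C : ℝ, ∀ s ∈ S, dist x (s • x) ≤ C

theorem isInvariantDist_dist [PseudoMetricSpace X] [MulAction Γ X] [IsIsometricSMul Γ X] :
    IsInvariantDist Γ (dist : X → X → ℝ) :=
  ⟨dist_self, fun _ _ => dist_nonneg, dist_triangle, fun g x y => dist_smul g x y⟩

theorem isInvariantDist_cayDist {S : Set Γ} (hS : Subsemigroup.closure S = ⊤) :
    IsInvariantDist Γ (cayDist S) := by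
  have hne : ∀ g : Γ, {n : ℕ | g ∈ S ^ n}.Nonempty := by
    intro g
    have hg : g ∈ Subsemigroup.closure S := by rw [hS]; trivial
    induction hg using Subsemigroup.closure_induction with
    | mem x hx => exact ⟨1, by simpa using hx⟩
    | mul x y _ _ hx hy =>
      obtain ⟨m, hm⟩ := hx
      obtain ⟨n, hn⟩ := hy
      exact ⟨m + n, by
        change x * y ∈ S ^ (m + n)
        rw [pow_add]; exact Set.mul_mem_mul hm hn⟩
  refine ⟨fun x => ?_, fun x y => Nat.cast_nonneg _, fun x y z => ?_, fun g x y => ?_⟩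
  · have h : wordLength S (1 : Γ) = 0 := Nat.sInf_eq_zero.2 (Or.inl (by simp))
    simp [cayDist, h]
  · have h1 : x⁻¹ * y ∈ S ^ wordLength S (x⁻¹ * y) := Nat.sInf_mem (hne _)
    have h2 : y⁻¹ * z ∈ S ^ wordLength S (y⁻¹ * z) := Nat.sInf_mem (hne _)
    have h3 : x⁻¹ * z ∈ S ^ (wordLength S (x⁻¹ * y) + wordLength S (y⁻¹ * z)) := by
      rw [pow_add]
      have := Set.mul_mem_mul h1 h2
      simpa [mul_assoc] using this
    have h4 : wordLength S (x⁻¹ * z) ≤ wordLength S (x⁻¹ * y) + wordLength S (y⁻¹ * z) :=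
      Nat.sInf_le h3
    unfold cayDist
    exact_mod_cast h4
  · simp [cayDist, mul_assoc]

end LengthSpectrum

end

/-! Let `T` be the supremum on the right and `A = T * L`. Elements of `S ^ L` and `S ^ (2 * L)` have
stable length at most `L` and `2 * L` for `S`, hence at most `A` and `2 * A` on `X`. It suffices to
find a point moved by at most `A + 18 * δ`, up to `ε`, by every element of `S ^ L`: iterating and
dividing by word length bounds the dilation by `T + 18 * δ / L`. Choose `s` in `S ^ L` almost
maximizing the displacement of `x`; the point is near the middle of a geodesic from `x` to `s x`.
Large displacement with small stable length forces `g x` and `g⁻¹ x` to share a long initial segment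
(`IsHyperbolic.le_gromovProduct_inv`). Chaining such overlaps bounds the displacements of `s * u`
and `u * s`, so `u` nearly fixes the middle (`IsHyperbolic.distSegment_smul_le_of_stableLength_le`).
As `X` need not be geodesic, `distSegment` replaces the point. -/

namespace LengthSpectrum

/-! ### Displacement and stable length in hyperbolic spaces. -/

section Hyperbolic

variable {Γ X : Type*} [Group Γ] [PseudoMetricSpace X] {δ : ℝ}

/-- The four-point inequality for sums of opposite sides. -/
theorem IsHyperbolic.dist_add_dist_le (hX : IsHyperbolic X δ) (x y z w : X) :
    dist x y + dist z w ≤ max (dist x z + dist y w) (dist x w + dist y z) + 2 * δ := by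
  have h := hX.2 x y z w
  simp only [gromovProduct, dist_comm z] at h
  rw [dist_comm z w]
  rcases le_total (dist x z + dist y w) (dist x w + dist y z) with h' | h'
  · rw [max_eq_right h']
    rcases min_choice ((dist x z + dist w z - dist x w) / 2)
      ((dist y z + dist w z - dist y w) / 2) with e | e <;> rw [e] at h <;> linarith
  · rw [max_eq_left h']
    rcases min_choice ((dist x z + dist w z - dist x w) / 2)
      ((dist y z + dist w z - dist y w) / 2) with e | e <;> rw [e] at h <;> linarith

/-- The ultrametric-type inequality for a lower bound of twice the Gromov product at `o`. -/
theorem IsHyperbolic.gromovProduct_trans (hX : IsHyperbolic X δ) {o a b c : X} {r q : ℝ}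
    (hab : r ≤ dist o a + dist o b - dist a b) (hbc : q ≤ dist o b + dist o c - dist b c) :
    min r q - 2 * δ ≤ dist o a + dist o c - dist a c := by
  have h := hX.dist_add_dist_le a c o b
  rw [dist_comm a o, dist_comm c b, dist_comm c o] at h
  rcases le_max_iff.1 (sub_le_iff_le_add.2 h) with h | h
  · linarith [min_le_right r q]
  · linarith [min_le_left r q]

variable [MulAction Γ X] [IsIsometricSMul Γ X]

theorem dist_inv_smul_right (g : Γ) (x : X) : dist x (g⁻¹ • x) = dist x (g • x) := by
  rw [← dist_smul g x (g⁻¹ • x), smul_inv_smul, dist_comm]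

theorem stableLength_dist_nonneg [Nonempty X] (g : Γ) :
    0 ≤ stableLength (dist : X → X → ℝ) g := by
  obtain ⟨x⟩ := ‹Nonempty X›
  exact ge_of_tendsto' (tendsto_stableLength isInvariantDist_dist g x)
    fun k => div_nonneg dist_nonneg (Nat.cast_nonneg k)

/-- In a hyperbolic space the displacement of `g ^ 2` exceeds that of `g` by at most the stable
translation length of `g`, up to an additive constant. -/
theorem IsHyperbolic.dist_sq_smul_le [Nonempty X] (hX : IsHyperbolic X δ) (g : Γ) (x : X) :
    dist x (g ^ 2 • x) ≤ dist x (g • x) + stableLength (dist : X → X → ℝ) g + 2 * δ := by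
  by_contra! hlt
  set c := dist x (g ^ 2 • x) - dist x (g • x) - 2 * δ with hc
  have hl := stableLength_dist_nonneg (X := X) g
  have hδ := hX.1
  have hc0 : 0 < c := by linarith
  -- The four-point inequality propagates the first gap `c` along the orbit, so the stable length
  -- would be at least `c`.
  have hstep : ∀ n : ℕ, dist x (g ^ (n + 1) • x) + c ≤ dist x (g ^ (n + 2) • x) := by
    intro n
    induction n with
    | zero => simp only [zero_add, pow_one]; linarith
    | succ n ih =>
      have h := hX.dist_add_dist_le x (g ^ 2 • x) (g • x) (g ^ (n + 3) • x)
      have e1 : dist (g • x) (g ^ (n + 3) • x) = dist x (g ^ (n + 2) • x) := by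
        rw [show g ^ (n + 3) = g * g ^ (n + 2) by rw [← pow_succ'], mul_smul, dist_smul]
      have e2 : dist (g ^ 2 • x) (g ^ (n + 3) • x) = dist x (g ^ (n + 1) • x) := by
        rw [show g ^ (n + 3) = g ^ 2 * g ^ (n + 1) by rw [← pow_add]; congr 1; omega,
          mul_smul, dist_smul]
      have e3 : dist (g ^ 2 • x) (g • x) = dist x (g • x) := by
        rw [pow_two, mul_smul, dist_smul, dist_comm]
      rw [e1, e2, e3] at h
      change dist x (g ^ (n + 2) • x) + c ≤ dist x (g ^ (n + 3) • x)
      rcases le_max_iff.1 (sub_le_iff_le_add.2 h) with h | h <;> linarith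
  have hlin : ∀ n : ℕ, n * c ≤ dist x (g ^ (n + 1) • x) := by
    intro n
    induction n with
    | zero => simp [dist_nonneg]
    | succ n ih => have := hstep n; push_cast; linarith
  have h1 : Tendsto (fun k : ℕ => c - c / (k : ℝ)) atTop (𝓝 (c - 0)) :=
    tendsto_const_nhds.sub (tendsto_const_div_atTop_nhds_zero_nat c)
  have h2 : c - 0 ≤ stableLength (dist : X → X → ℝ) g := by
    refine le_of_tendsto_of_tendsto h1 (tendsto_stableLength isInvariantDist_dist g x) ?_
    filter_upwards [eventually_ge_atTop 1] with k hk
    obtain ⟨n, rfl⟩ := Nat.exists_eq_add_of_le' hk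
    have hn : (0 : ℝ) < ((n + 1 : ℕ) : ℝ) := by positivity
    rw [le_div_iff₀ hn, sub_mul, div_mul_cancel₀ _ hn.ne']
    have := hlin n
    push_cast
    linarith
  linarith

/-- A lower bound for twice the Gromov product `(g⁻¹ x | g x)_x`. -/
theorem IsHyperbolic.le_gromovProduct_inv [Nonempty X] (hX : IsHyperbolic X δ) (g : Γ) (x : X) :
    dist x (g • x) - stableLength (dist : X → X → ℝ) g - 2 * δ ≤
      dist x (g⁻¹ • x) + dist x (g • x) - dist (g⁻¹ • x) (g • x) := by
  have h := hX.dist_sq_smul_le g x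
  have e : dist (g⁻¹ • x) (g • x) = dist x (g ^ 2 • x) := by
    rw [← dist_smul g (g⁻¹ • x) (g • x), smul_inv_smul, pow_two, mul_smul]
  rw [e, dist_inv_smul_right]
  linarith

theorem IsHyperbolic.le_gromovProduct_inv_right [Nonempty X] (hX : IsHyperbolic X δ) (g : Γ)
    (x : X) :
    dist x (g • x) - stableLength (dist : X → X → ℝ) g - 2 * δ ≤
      dist x (g • x) + dist x (g⁻¹ • x) - dist (g • x) (g⁻¹ • x) := by
  rw [dist_comm (g • x), add_comm (dist x (g • x))]
  exact hX.le_gromovProduct_inv g x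

/-- The displacement of a product `f * g`, bounded in terms of the displacements of the factors
and of the stable translation lengths of `f`, `g` and `f * g`. -/
theorem IsHyperbolic.dist_mul_smul_le [Nonempty X] (hX : IsHyperbolic X δ) {f g : Γ} {x : X}
    {A M : ℝ} (hf : stableLength (dist : X → X → ℝ) f ≤ A)
    (hg : stableLength (dist : X → X → ℝ) g ≤ A)
    (hfg : stableLength (dist : X → X → ℝ) (f * g) ≤ 2 * A)
    (hMf : dist x (f • x) ≤ M) (hMg : dist x (g • x) ≤ M) :
    dist x ((f * g) • x) ≤ M + A + 10 * δ := by
  have hA := (stableLength_dist_nonneg (X := X) f).trans hf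
  have hδ := hX.1
  have h1 := hX.le_gromovProduct_inv f x
  have h2 : dist x (f • x) + dist x ((f * g) • x) - dist x (g • x) ≤
      dist x (f • x) + dist x ((f * g) • x) - dist (f • x) ((f * g) • x) := by
    rw [mul_smul, dist_smul]
  have h3 := hX.le_gromovProduct_inv_right (f * g) x
  have h4 : dist x (g • x) + dist x ((f * g) • x) - dist x (f • x) ≤
      dist x ((f * g)⁻¹ • x) + dist x (g⁻¹ • x) - dist ((f * g)⁻¹ • x) (g⁻¹ • x) := by
    rw [dist_inv_smul_right, dist_inv_smul_right, mul_inv_rev, mul_smul g⁻¹, dist_smul,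
      dist_comm _ x, dist_inv_smul_right]
    linarith
  have h5 := hX.le_gromovProduct_inv g x
  -- Chain at `x` through `f⁻¹x, fx, fgx, (fg)⁻¹x, g⁻¹x, gx`. The four transitions cost `8 * δ`; a
  -- pair of inverses costs another `2 * δ`.
  have h := hX.gromovProduct_trans (hX.gromovProduct_trans (hX.gromovProduct_trans
    (hX.gromovProduct_trans h1 h2) h3) h4) h5
  have e : dist (f⁻¹ • x) (g • x) = dist x ((f * g) • x) := by
    rw [← dist_smul f (f⁻¹ • x) (g • x), smul_inv_smul, mul_smul]
  rw [e, dist_inv_smul_right] at h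
  simp only [min_def] at h
  split_ifs at h <;> linarith

/-! ### Virtual points on segments. -/

/-- The function on `X` that plays the role of the distance to the point at distance `t` from `x`
on a geodesic from `x` to `y`. Such a point need not exist in `X`. -/
def distSegment (x y : X) (t : ℝ) (z : X) : ℝ :=
  max (dist x z - t) (dist y z - (dist x y - t))

theorem distSegment_le_add_dist (x y : X) (t : ℝ) (z w : X) :
    distSegment x y t w ≤ distSegment x y t z + dist z w := by
  unfold distSegment
  rw [← max_add_add_right]
  exact max_le_max (by linarith [dist_triangle x z w]) (by linarith [dist_triangle y z w])

/-- The hypotheses are the triangle inequalities that would hold if the virtual point were moved by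
at most `B`. Conversely, the four-point condition recovers the distance to `u z` from those to `u x`
and `u y`. -/
theorem IsHyperbolic.distSegment_smul_le (hX : IsHyperbolic X δ) {x y : X} {t B : ℝ} {u : Γ}
    (hxx : dist x (u • x) - 2 * t ≤ B) (hxy : dist x (u • y) - dist x y ≤ B)
    (hyx : dist y (u • x) - dist x y ≤ B)
    (hyy : dist y (u • y) - 2 * (dist x y - t) ≤ B) (z : X) :
    distSegment x y t (u • z) ≤ distSegment x y t z + B + 2 * δ := by
  have h1 : dist x z - t ≤ distSegment x y t z := le_max_left _ _
  have h2 : dist y z - (dist x y - t) ≤ distSegment x y t z := le_max_right _ _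
  have key : ∀ p : X, dist p (u • z) + dist x y ≤
      max (dist p (u • x) + dist y z) (dist p (u • y) + dist x z) + 2 * δ := by
    intro p
    have h := hX.dist_add_dist_le p (u • z) (u • x) (u • y)
    rwa [dist_smul, dist_smul, dist_smul, dist_comm z y, dist_comm z x] at h
  refine max_le ?_ ?_
  · rcases le_max_iff.1 (sub_le_iff_le_add.2 (key x)) with h | h <;> linarith
  · rcases le_max_iff.1 (sub_le_iff_le_add.2 (key y)) with h | h <;> linarith

/-- If `s` almost maximizes the displacement of `x`, then a suitable virtual point between `x` and
`s x` is moved by `u` by at most `A`, up to an additive constant, when `A` bounds the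
stable translation lengths of `s`, `u` and half of those of their products. -/
theorem IsHyperbolic.distSegment_smul_le_of_stableLength_le [Nonempty X] (hX : IsHyperbolic X δ)
    {s u : Γ} {x : X} {A ε : ℝ} (hε : 0 ≤ ε) (hs : stableLength (dist : X → X → ℝ) s ≤ A)
    (hu : stableLength (dist : X → X → ℝ) u ≤ A)
    (hsu : stableLength (dist : X → X → ℝ) (s * u) ≤ 2 * A)
    (hus : stableLength (dist : X → X → ℝ) (u * s) ≤ 2 * A)
    (hmax : dist x (u • x) ≤ dist x (s • x) + ε) (z : X) :
    distSegment x (s • x) ((dist x (s • x) - A) / 2) (u • z) ≤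
      distSegment x (s • x) ((dist x (s • x) - A) / 2) z + (A + 18 * δ + ε) := by
  have hδ := hX.1
  have hA := (stableLength_dist_nonneg (X := X) s).trans hs
  have hMs : dist x (s • x) ≤ dist x (s • x) + ε := by linarith
  have hdsu := hX.dist_mul_smul_le hs hu hsu hMs hmax
  have hdus := hX.dist_mul_smul_le hu hs hus hmax hMs
  have hss := hX.le_gromovProduct_inv s x
  have hyx : dist (s • x) (u • x) ≤ dist x (s • x) + A + 12 * δ + ε := by
    have h2 : dist x (s • x) + dist x (u • x) - dist x ((s * u) • x) ≤
        dist x (s⁻¹ • x) + dist x (u • x) - dist (s⁻¹ • x) (u • x) := by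
      rw [dist_inv_smul_right, ← dist_smul s (s⁻¹ • x) (u • x), smul_inv_smul, mul_smul]
    have h := hX.gromovProduct_trans (hX.le_gromovProduct_inv_right s x) h2
    simp only [min_def] at h
    split_ifs at h <;> linarith
  have hyy : dist (s • x) (u • s • x) ≤ dist x (s • x) + 2 * A + 16 * δ + ε := by
    have h1 := hX.le_gromovProduct_inv_right (u * s) x
    have h2 : dist x ((u * s) • x) + dist x (s • x) - dist x (u • x) ≤
        dist x ((u * s)⁻¹ • x) + dist x (s⁻¹ • x) - dist ((u * s)⁻¹ • x) (s⁻¹ • x) := by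
      rw [dist_inv_smul_right, dist_inv_smul_right, mul_inv_rev, mul_smul s⁻¹, dist_smul,
        dist_comm _ x, dist_inv_smul_right]
    have h := hX.gromovProduct_trans (hX.gromovProduct_trans h1 h2) hss
    rw [dist_comm ((u * s) • x), mul_smul] at h
    rw [mul_smul] at hdus
    simp only [min_def] at h
    split_ifs at h <;> linarith
  rw [mul_smul] at hdus
  -- The shift of the midpoint by `A / 2` balances the two ends: `u` may move `s x` by about `2 * A`
  -- more than the bound for `x`.
  have h := hX.distSegment_smul_le (x := x) (y := s • x) (t := (dist x (s • x) - A) / 2)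
    (B := A + 16 * δ + ε) (u := u) (by linarith) (by linarith) (by linarith) (by linarith) z
  linarith

end Hyperbolic

/-! ### Word length and its stable length. -/

section WordLength

variable {Γ X : Type*} [Group Γ] {S : Set Γ}

theorem mem_pow_wordLength (hS : Subsemigroup.closure S = ⊤) (g : Γ) :
    g ∈ S ^ wordLength S g := by
  refine Nat.sInf_mem (s := {n : ℕ | g ∈ S ^ n}) ?_
  have hg : g ∈ Subsemigroup.closure S := by rw [hS]; trivial
  induction hg using Subsemigroup.closure_induction with
  | mem x hx => exact ⟨1, by simpa using hx⟩
  | mul x y _ _ hx hy =>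
    obtain ⟨m, hm⟩ := hx
    obtain ⟨n, hn⟩ := hy
    exact ⟨m + n, show x * y ∈ S ^ (m + n) by rw [pow_add]; exact Set.mul_mem_mul hm hn⟩

theorem nonempty_of_closure_eq_top (hS : Subsemigroup.closure S = ⊤) : S.Nonempty := by
  rw [Set.nonempty_iff_ne_empty]
  rintro rfl
  have h : (1 : Γ) ∈ Subsemigroup.closure (∅ : Set Γ) := by rw [hS]; trivial
  rw [Subsemigroup.closure_empty] at h
  exact h

theorem tendsto_wordLength_div (hS : Subsemigroup.closure S = ⊤) (g : Γ) :
    Tendsto (fun k : ℕ => (wordLength S (g ^ k) : ℝ) / k) atTop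
      (𝓝 (stableLength (cayDist S) g)) := by
  simpa [cayDist] using tendsto_stableLength (isInvariantDist_cayDist hS) g 1

theorem stableLength_cayDist_nonneg (hS : Subsemigroup.closure S = ⊤) (g : Γ) :
    0 ≤ stableLength (cayDist S) g :=
  ge_of_tendsto' (tendsto_wordLength_div hS g) fun k => by positivity

theorem stableLength_cayDist_le (hS : Subsemigroup.closure S = ⊤) {g : Γ} {n : ℕ}
    (hg : g ∈ S ^ n) : stableLength (cayDist S) g ≤ n := by
  refine le_of_tendsto (tendsto_wordLength_div hS g) ?_
  filter_upwards [eventually_ge_atTop 1] with k hk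
  have h : wordLength S (g ^ k) ≤ n * k :=
    Nat.sInf_le (show g ^ k ∈ S ^ (n * k) by rw [pow_mul]; exact Set.pow_mem_pow hg)
  rw [div_le_iff₀ (by positivity)]
  exact_mod_cast h

/-- A linear bound for displacements in terms of word lengths bounds stable translation
lengths. -/
theorem stableLength_dist_le_of_dist_le [PseudoMetricSpace X] [MulAction Γ X]
    [IsIsometricSMul Γ X] [Nonempty X] (hS : Subsemigroup.closure S = ⊤) {x : X} {B C : ℝ}
    (h : ∀ g : Γ, dist x (g • x) ≤ C + B * wordLength S g) (g : Γ) :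
    stableLength (dist : X → X → ℝ) g ≤ B * stableLength (cayDist S) g := by
  have h1 := (tendsto_const_div_atTop_nhds_zero_nat C).add
    ((tendsto_wordLength_div hS g).const_mul B)
  rw [zero_add] at h1
  refine le_of_tendsto_of_tendsto' (tendsto_stableLength isInvariantDist_dist g x) h1 fun k => ?_
  rw [← mul_div_assoc, ← add_div]
  exact div_le_div_of_nonneg_right (h _) (Nat.cast_nonneg k)

theorem le_add_mul_of_mem_pow [MulAction Γ X] {F : X → ℝ} {T : Set Γ} {B : ℝ}
    (hF : ∀ u ∈ T, ∀ z, F (u • z) ≤ F z + B) {n : ℕ} {g : Γ} (hg : g ∈ T ^ n) (z : X) :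
    F (g • z) ≤ F z + n * B := by
  induction n generalizing g z with
  | zero =>
    obtain rfl : g = 1 := by simpa using hg
    simp
  | succ n ih =>
    rw [pow_succ] at hg
    obtain ⟨a, ha, u, hu, rfl⟩ := Set.mem_mul.1 hg
    rw [mul_smul]
    have h1 := ih ha (u • z)
    have h2 := hF u hu z
    push_cast
    linarith

end WordLength

/-! ### From bounds on `S ^ L` and `S ^ (2 * L)` to all of `Γ`. -/

section Main

variable {Γ X : Type*} [Group Γ] [PseudoMetricSpace X] [MulAction Γ X] [IsIsometricSMul Γ X]
  {S : Set Γ} {δ : ℝ}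

theorem dist_smul_le_of_mem_pow {x : X} {C : ℝ} (hC : ∀ s ∈ S, dist x (s • x) ≤ C) {n : ℕ}
    {g : Γ} (hg : g ∈ S ^ n) : dist x (g • x) ≤ n * C := by
  induction n generalizing g with
  | zero =>
    obtain rfl : g = 1 := by simpa using hg
    simp
  | succ n ih =>
    rw [pow_succ] at hg
    obtain ⟨a, ha, s, hs, rfl⟩ := Set.mem_mul.1 hg
    have h1 := dist_triangle x (a • x) (a • s • x)
    rw [dist_smul] at h1
    rw [mul_smul]
    push_cast
    linarith [ih ha, hC s hs]

theorem stableLength_dist_le_mul_cayDist [Nonempty X] (hS : Subsemigroup.closure S = ⊤) {x : X}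
    {C : ℝ} (hC : ∀ s ∈ S, dist x (s • x) ≤ C) (g : Γ) :
    stableLength (dist : X → X → ℝ) g ≤ C * stableLength (cayDist S) g := by
  refine stableLength_dist_le_of_dist_le hS (x := x) (C := 0) (fun g => ?_) g
  rw [zero_add, mul_comm]
  exact dist_smul_le_of_mem_pow hC (mem_pow_wordLength hS g)

/-- A bound `A` for the stable translation lengths on `S ^ L` and for half of those on
`S ^ (2 * L)` yields a linear bound for all stable translation lengths. -/
theorem IsHyperbolic.stableLength_le_of_pow [Nonempty X] (hX : IsHyperbolic X δ)
    (hS : Subsemigroup.closure S = ⊤) (hb : IsBoundedFor X S) {L : ℕ} (hL : 1 ≤ L) {A : ℝ}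
    (h1 : ∀ g ∈ S ^ L, stableLength (dist : X → X → ℝ) g ≤ A)
    (h2 : ∀ g ∈ S ^ (2 * L), stableLength (dist : X → X → ℝ) g ≤ 2 * A) (g : Γ) :
    stableLength (dist : X → X → ℝ) g ≤ (A + 18 * δ) / L * stableLength (cayDist S) g := by
  obtain ⟨x, C, hC⟩ := hb
  obtain ⟨s₀, hs₀⟩ := nonempty_of_closure_eq_top hS
  have hC0 : 0 ≤ C := dist_nonneg.trans (hC s₀ hs₀)
  have hL0 : (0 : ℝ) < L := by exact_mod_cast hL
  have hA : 0 ≤ A :=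
    (stableLength_dist_nonneg (X := X) (s₀ ^ L)).trans (h1 _ (Set.pow_mem_pow hs₀))
  have hδ := hX.1
  have main : ∀ ε : ℝ, 0 < ε → stableLength (dist : X → X → ℝ) g ≤
      (A + 18 * δ + ε) / L * stableLength (cayDist S) g := by
    intro ε hε
    obtain ⟨s, hs, hmax⟩ : ∃ s ∈ S ^ L, ∀ u ∈ S ^ L, dist x (u • x) ≤ dist x (s • x) + ε := by
      have hne : ((fun u : Γ => dist x (u • x)) '' (S ^ L)).Nonempty :=
        ⟨_, _, Set.pow_mem_pow hs₀, rfl⟩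
      have hbdd : BddAbove ((fun u : Γ => dist x (u • x)) '' (S ^ L)) := by
        refine ⟨L * C, ?_⟩
        rintro _ ⟨u, hu, rfl⟩
        exact dist_smul_le_of_mem_pow hC hu
      obtain ⟨_, ⟨s, hs, rfl⟩, hlt⟩ := exists_lt_of_lt_csSup hne (sub_lt_self _ hε)
      refine ⟨s, hs, fun u hu => ?_⟩
      have := le_csSup hbdd ⟨u, hu, rfl⟩
      simp only at this hlt
      linarith
    have hmul : ∀ a ∈ S ^ L, ∀ b ∈ S ^ L,
        stableLength (dist : X → X → ℝ) (a * b) ≤ 2 * A := fun a ha b hb =>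
      h2 _ (by rw [two_mul, pow_add]; exact Set.mul_mem_mul ha hb)
    set t := (dist x (s • x) - A) / 2
    have hF : ∀ u ∈ S ^ L, ∀ z, distSegment x (s • x) t (u • z) ≤
        distSegment x (s • x) t z + (A + 18 * δ + ε) := fun u hu z =>
      hX.distSegment_smul_le_of_stableLength_le hε.le (h1 s hs) (h1 u hu) (hmul s hs u hu)
        (hmul u hu s hs) (hmax u hu) z
    refine stableLength_dist_le_of_dist_le hS (x := x)
      (C := distSegment x (s • x) t x + t + L * C) (fun h => ?_) g
    have hh := mem_pow_wordLength hS h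
    -- Cut the word into blocks of length `L`; the remainder moves `x` by at most `L * C`, which
    -- vanishes in the stable limit.
    rw [← Nat.div_add_mod (wordLength S h) L, pow_add, pow_mul] at hh
    obtain ⟨a, ha, r, hr, rfl⟩ := Set.mem_mul.1 hh
    have i1 := le_add_mul_of_mem_pow hF ha (r • x)
    have i2 := distSegment_le_add_dist x (s • x) t x (r • x)
    have i3 := dist_smul_le_of_mem_pow hC hr
    have i4 : dist x ((a * r) • x) - t ≤ distSegment x (s • x) t ((a * r) • x) :=
      le_max_left _ _
    rw [mul_smul] at i4 ⊢
    have i5 : ((wordLength S (a * r) % L : ℕ) : ℝ) * C ≤ L * C :=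
      mul_le_mul_of_nonneg_right (by exact_mod_cast (Nat.mod_lt _ hL).le) hC0
    have i6 : ((wordLength S (a * r) / L : ℕ) : ℝ) * (A + 18 * δ + ε) ≤
        (A + 18 * δ + ε) / L * wordLength S (a * r) := by
      have : ((wordLength S (a * r) / L : ℕ) : ℝ) ≤ wordLength S (a * r) / L := Nat.cast_div_le
      calc _ ≤ (wordLength S (a * r) / L : ℝ) * (A + 18 * δ + ε) :=
            mul_le_mul_of_nonneg_right this (by linarith)
        _ = _ := by ring
    linarith
  have hlim : Tendsto (fun ε : ℝ => (A + 18 * δ + ε) / L * stableLength (cayDist S) g)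
      (𝓝[>] 0) (𝓝 ((A + 18 * δ + 0) / L * stableLength (cayDist S) g)) := by
    refine Tendsto.mono_left (Continuous.tendsto ?_ 0) nhdsWithin_le_nhds
    fun_prop
  rw [add_zero] at hlim
  exact ge_of_tendsto hlim (eventually_mem_nhdsWithin.mono main)

end Main

end LengthSpectrum

theorem mainTheorem2 :
    ∃ K : ℝ, 0 < K ∧
      ∀ (Γ : Type*) [Group Γ] (X : Type*) [MetricSpace X] [Nonempty X]
        [MulAction Γ X] [IsIsometricSMul Γ X] (δ : ℝ) (S : Set Γ),
        LengthSpectrum.IsHyperbolic X δ →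
        LengthSpectrum.IsNonelementary Γ X →
        Subsemigroup.closure S = ⊤ →
        LengthSpectrum.IsBoundedFor X S →
        ∀ L : ℕ, 1 ≤ L →
          LengthSpectrum.dilation Γ (dist : X → X → ℝ) (LengthSpectrum.cayDist S) ≤
            ENNReal.ofReal (K * δ / L) +
              ⨆ (g : Γ) (_ : 0 < LengthSpectrum.stableLength (LengthSpectrum.cayDist S) g ∧
                  LengthSpectrum.stableLength (LengthSpectrum.cayDist S) g ≤ 2 * L),
                ENNReal.ofReal
                  (LengthSpectrum.stableLength (dist : X → X → ℝ) g /
                    LengthSpectrum.stableLength (LengthSpectrum.cayDist S) g) := by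
  open LengthSpectrum in
  refine ⟨18, by norm_num, ?_⟩
  intro Γ _ X _ _ _ _ δ S hX _ hS hb L hL
  set T : ℝ≥0∞ := ⨆ (g : Γ) (_ : 0 < stableLength (cayDist S) g ∧
    stableLength (cayDist S) g ≤ 2 * L),
      ENNReal.ofReal (stableLength (dist : X → X → ℝ) g / stableLength (cayDist S) g) with hT
  rcases eq_or_ne T ⊤ with hT' | hT'
  · simp [hT']
  have hδ := hX.1
  have hL0 : (0 : ℝ) < L := by exact_mod_cast hL
  have hratio : ∀ g : Γ, stableLength (cayDist S) g ≤ 2 * L →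
      stableLength (dist : X → X → ℝ) g ≤ T.toReal * stableLength (cayDist S) g := by
    intro g hg
    rcases (stableLength_cayDist_nonneg hS g).eq_or_lt with h0 | h0
    -- Elements with `ℓ_S = 0` are not in the supremum; boundedness of `S` gives them stable length
    -- `0` on `X`.
    · obtain ⟨x, C, hC⟩ := hb
      have := stableLength_dist_le_mul_cayDist hS hC g
      rw [← h0, mul_zero] at this ⊢
      exact this
    · have h : ENNReal.ofReal (stableLength (dist : X → X → ℝ) g / stableLength (cayDist S) g)
          ≤ T := le_iSup₂_of_le g ⟨h0, hg⟩ le_rfl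
      rw [← div_le_iff₀ h0]
      exact (ENNReal.ofReal_le_iff_le_toReal hT').1 h
  have hbound : ∀ g : Γ, stableLength (dist : X → X → ℝ) g ≤
      (18 * δ / L + T.toReal) * stableLength (cayDist S) g := by
    intro g
    have h := hX.stableLength_le_of_pow hS hb hL (A := T.toReal * L) (fun g hg => ?_)
      (fun g hg => ?_) g
    · convert h using 2
      field_simp
      ring
    · have hl := stableLength_cayDist_le hS hg
      exact (hratio g (by linarith)).trans (mul_le_mul_of_nonneg_left hl ENNReal.toReal_nonneg)
    · have hl := stableLength_cayDist_le hS hg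
      push_cast at hl
      refine (hratio g hl).trans
        ((mul_le_mul_of_nonneg_left hl ENNReal.toReal_nonneg).trans_eq (by ring))
  have hη : 0 ≤ 18 * δ / L + T.toReal := by positivity
  have hsum : ENNReal.ofReal (18 * δ / L + T.toReal) = ENNReal.ofReal (18 * δ / L) + T := by
    rw [ENNReal.ofReal_add (by positivity) ENNReal.toReal_nonneg, ENNReal.ofReal_toReal hT']
  rw [← hsum]
  -- The dilation only admits `η > 0`, while the bound obtained may be `0`.
  refine ENNReal.le_of_forall_pos_le_add fun ε hε _ => ?_
  have hε' : (0 : ℝ) < ε := hε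
  rw [← ENNReal.ofReal_coe_nnreal, ← ENNReal.ofReal_add hη hε'.le]
  refine sInf_le ⟨_, by positivity, fun g => (hbound g).trans ?_, rfl⟩
  exact mul_le_mul_of_nonneg_right (by linarith) (stableLength_cayDist_nonneg hS g)
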